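/- Let $T$ be the dyadic tree of depth $N$, whose nodes are the dyadic subintervals of $[0,1]$ of length at least $2^{-N}$. Let $T^2=T\times T$ be the bi-tree, whose nodes $\alpha$ correspond to dyadic rectangles $R_\alpha\subset[0,1]^2$, with $\alpha\le\beta$ if and only if $R_\alpha\subseteq R_\beta$; let $\partial T^2$ be the set of nodes $\omega$ whose $R_\omega$ is a square of side $2^{-N}$. For a non-negative measure $\mu$ on $\partial T^2$ and $\alpha\in T^2$ put $\mu(R_\alpha)=\mathbb I^*\mu(\alpha)=\sum_{\omega\in\partial T^2,\,\omega\le\alpha}\mu(\omega)$ and $$\mathbb V^\mu(\alpha)=\sum_{\beta\ge\alpha}\mu(R_\beta),\qquad \mathcal E[\mu]=\int\mathbb V^\mu\,d\mu=\sum_{\alpha\in T^2}\mu(R_\alpha)^2 .$$ For $\delta>0$ let $E_\delta=\{\beta\in T^2:\mathbb V^\mu(\beta)<\delta\}$ and $$\mathbb V^\mu_\delta(\alpha)=\sum_{\beta\ge\alpha,\ \beta\in E_\delta}\mu(R_\beta),\qquad \mathcal E_\delta[\mu]=\int\mathbb V^\mu_\delta\,d\mu=\sum_{\alpha\in E_\delta}\mu(R_\alpha)^2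 .$$ For $E\subseteq\partial T^2$ let $U_E=\bigcup_{\omega\in E}R_\omega$, and let $\mathcal E_E[\mu]=\sum_{\alpha\in T^2:\,R_\alpha\subseteq U_E}\mu(R_\alpha)^2$ be the local energy of $\mu$ on $E$. Finally, let $\{\mathbb V^\mu\ge\delta\}$ denote the set of all $\omega\in\partial T^2$ with $\mathbb V^\mu(\omega)\ge\delta$. There is an absolute constant $C>0$ (independent of $N$, of the measure and of $\delta$) such that the following two statements hold for every $N\ge0$. (1) If $\mu\ge0$ is a measure on $\partial T^2$ with $\mathbb V^\mu\ge1$ on $\operatorname{supp}\mu$, then for every $\delta>0$ $$\mathcal E_\delta[\mu]\le C\,\delta^{1/2}\,\mathcal E[\mu],$$ and $$\mathcal E_{\{\mathbb V^\mu\ge\delta\}}[\mu]\ \ge\sum_{\alpha\in T^2:\ \mathbb V^\mu(\alpha)\ge\delta}\mu(R_\alpha)^2=\mathcal E[\mu]-\mathcal E_\delta[\mu]\ \ge\ (1-C\delta^{1/2})\,\mathcal E[\mu],$$ so that $\mathcal E_{\{\mathbb V^\mu\ge\delta\}}[\mu]\ge(1-C\delta^{1/2})\,\mathcal E[\mu]$.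 (2) If $\nu\ge0$ is a measure on $\partial T^2$ and $C_1>0$ is such that $\mathbb V^\nu\ge C_1$ on $\operatorname{supp}\nu$, then, with $E=\{\mathbb V^\nu\ge C_1/(4C)\}$, $$\mathcal E_E[\nu]\ge\tfrac12\,\mathcal E[\nu].$$ -/

import Mathlib

noncomputable section

namespace BiTreeEnergy

/-- A node of the finite dyadic tree `T` of depth `N`, i.e. a dyadic subinterval of `[0,1]` of
length `2^(-gen)`, `gen ≤ N`; it is the `pos`-th such interval from the left. -/
@[ext] structure Node (N : ℕ) where
  gen : ℕ
  pos : ℕ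
  gen_le : gen ≤ N
  pos_lt : pos < 2 ^ gen

namespace Node

variable {N : ℕ}

/-- The dyadic interval of a node (half-open, so that intervals of one generation are disjoint). -/
def interval (a : Node N) : Set ℝ :=
  Set.Ico ((a.pos : ℝ) / 2 ^ a.gen) (((a.pos : ℝ) + 1) / 2 ^ a.gen)

theorem interval_nonempty (a : Node N) : a.interval.Nonempty := by
  refine Set.nonempty_Ico.2 ?_
  gcongr
  linarith

theorem interval_subset_iff (a b : Node N) :
    a.interval ⊆ b.interval ↔ b.gen ≤ a.gen ∧ a.pos / 2 ^ (a.gen - b.gen) = b.pos := by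
  have hne := Set.nonempty_Ico.1 a.interval_nonempty
  unfold interval
  rw [Set.Ico_subset_Ico_iff hne]
  have hA : (0 : ℝ) < 2 ^ a.gen := by positivity
  have hB : (0 : ℝ) < 2 ^ b.gen := by positivity
  have key : b.gen ≤ a.gen →
      (((b.pos : ℝ) / 2 ^ b.gen ≤ (a.pos : ℝ) / 2 ^ a.gen ∧
        ((a.pos : ℝ) + 1) / 2 ^ a.gen ≤ ((b.pos : ℝ) + 1) / 2 ^ b.gen) ↔
        a.pos / 2 ^ (a.gen - b.gen) = b.pos) := by
    intro h
    obtain ⟨d, hd⟩ := Nat.exists_eq_add_of_le h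
    rw [hd, Nat.add_sub_cancel_left, pow_add, Nat.div_eq_iff (by positivity)]
    have h1 : (b.pos : ℝ) / 2 ^ b.gen ≤ (a.pos : ℝ) / (2 ^ b.gen * 2 ^ d) ↔
        b.pos * 2 ^ d ≤ a.pos := by
      rw [div_le_div_iff₀ hB (by positivity), ← mul_assoc, mul_right_comm,
        mul_le_mul_iff_left₀ hB]
      exact_mod_cast Iff.rfl
    have h2 : ((a.pos : ℝ) + 1) / (2 ^ b.gen * 2 ^ d) ≤ ((b.pos : ℝ) + 1) / 2 ^ b.gen ↔
        a.pos + 1 ≤ (b.pos + 1) * 2 ^ d := by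
      rw [div_le_div_iff₀ (by positivity) hB, ← mul_assoc,
        mul_right_comm, mul_le_mul_iff_left₀ hB]
      exact_mod_cast Iff.rfl
    rw [h1, h2]
    have hp : 0 < 2 ^ d := by positivity
    rw [Nat.add_mul, Nat.one_mul]
    omega
  constructor
  · intro h
    have hg : b.gen ≤ a.gen := by
      have h3 : (1 : ℝ) / 2 ^ a.gen ≤ 1 / 2 ^ b.gen := by
        have e1 := add_div (a.pos : ℝ) 1 (2 ^ a.gen)
        have e2 := add_div (b.pos : ℝ) 1 (2 ^ b.gen)
        linarith [h.1, h.2]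
      rw [one_div_le_one_div hA hB] at h3
      exact (pow_le_pow_iff_right₀ (by norm_num)).1 h3
    exact ⟨hg, (key hg).1 h⟩
  · rintro ⟨hg, h⟩
    exact (key hg).2 h

theorem interval_injective : Function.Injective (interval : Node N → Set ℝ) := by
  intro a b h
  obtain ⟨h1, h2⟩ := (interval_subset_iff a b).1 h.subset
  obtain ⟨h3, -⟩ := (interval_subset_iff b a).1 h.symm.subset
  have hg : a.gen = b.gen := le_antisymm h3 h1
  refine Node.ext hg ?_
  rw [hg] at h2
  simpa using h2

/-- `a ≤ b` means that the interval of `a` is contained in the interval of `b`. -/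
instance : PartialOrder (Node N) := PartialOrder.lift interval interval_injective

theorem le_iff (a b : Node N) :
    a ≤ b ↔ b.gen ≤ a.gen ∧ a.pos / 2 ^ (a.gen - b.gen) = b.pos :=
  interval_subset_iff a b

instance : Fintype (Node N) :=
  Fintype.ofInjective
    (fun a : Node N =>
      (⟨⟨a.gen, Nat.lt_succ_of_le a.gen_le⟩, ⟨a.pos, a.pos_lt⟩⟩ :
        Σ n : Fin (N + 1), Fin (2 ^ (n : ℕ))))
    (by
      intro a b h
      cases a
      cases b
      simp only [Sigma.mk.injEq, Fin.mk.injEq] at h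
      obtain ⟨rfl, h⟩ := h
      simpa using h)

end Node

/-- The bi-tree `T² = T × T`, with the coordinatewise order. -/
abbrev BiTree (N : ℕ) : Type := Node N × Node N

variable {N : ℕ}

/-- The dyadic rectangle `R_α` of a node `α` of the bi-tree. -/
def rect (α : BiTree N) : Set (ℝ × ℝ) := α.1.interval ×ˢ α.2.interval

/-- `α ≤ β` if and only if `R_α ⊆ R_β`. -/
theorem le_iff_rect_subset (α β : BiTree N) : α ≤ β ↔ rect α ⊆ rect β := by
  have h1 := α.1.interval_nonempty.ne_empty
  have h2 := α.2.interval_nonempty.ne_empty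
  unfold rect
  rw [Set.prod_subset_prod_iff]
  simp only [h1, h2, or_false]
  exact Iff.rfl

/-- The boundary `∂T² = (∂T)²`: the squares of side length `2^(-N)`. -/
def boundary (N : ℕ) : Set (BiTree N) := {ω | ω.1.gen = N ∧ ω.2.gen = N}

/-- A positive (i.e. non-negative) measure on `∂T²`, given by its masses: a non-negative function
on `T²` that vanishes off the boundary. -/
structure IsBoundaryMeasure (μ : BiTree N → ℝ) : Prop where
  nonneg : ∀ α, 0 ≤ μ α
  eq_zero : ∀ α, α ∉ boundary N → μ α = 0

open Classical in
/-- The Hardy operator `𝕀 φ (α) = ∑_{β ≥ α} φ(β)`. -/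
def hardy (φ : BiTree N → ℝ) (α : BiTree N) : ℝ := ∑ β with α ≤ β, φ β

open Classical in
/-- The dual Hardy operator `𝕀* ψ (α) = ∑_{β ≤ α} ψ(β)`. For a measure `μ` on the boundary,
`𝕀* μ (α) = μ(R_α)`. -/
def hardyDual (ψ : BiTree N → ℝ) (α : BiTree N) : ℝ := ∑ β with β ≤ α, ψ β

/-- The potential `𝕍^μ = 𝕀 (𝕀* μ)`. -/
def potential (μ : BiTree N → ℝ) : BiTree N → ℝ := hardy (hardyDual μ)

/-- The energy `𝓔[μ] = ∫ 𝕍^μ dμ`. -/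
def energy (μ : BiTree N → ℝ) : ℝ := ∑ α, potential μ α * μ α

/-- The set `E_δ` of the nodes at which the potential is below `δ`. -/
def lowNodes (μ : BiTree N → ℝ) (δ : ℝ) : Set (BiTree N) := {α | potential μ α < δ}

open Classical in
/-- The truncated potential `𝕍_δ^μ (α) = ∑_{β ≥ α, β ∈ E_δ} 𝕀* μ (β)`. -/
def lowPotential (μ : BiTree N → ℝ) (δ : ℝ) (α : BiTree N) : ℝ :=
  ∑ β with α ≤ β ∧ β ∈ lowNodes μ δ, hardyDual μ β

/-- The truncated energy `𝓔_δ[μ] = ∫ 𝕍_δ^μ dμ`. -/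
def lowEnergy (μ : BiTree N → ℝ) (δ : ℝ) : ℝ := ∑ α, lowPotential μ δ α * μ α

/-- The union `U_E` of the squares `R_ω`, `ω ∈ E`. -/
def squaresUnion (E : Set (BiTree N)) : Set (ℝ × ℝ) := ⋃ ω ∈ E, rect ω

open Classical in
/-- The local energy `𝓔_E[μ] = ∑_{R ⊆ U_E} μ(R)²` of `μ` on a set `E ⊆ ∂T²`. -/
def localEnergy (μ : BiTree N → ℝ) (E : Set (BiTree N)) : ℝ :=
  ∑ α with rect α ⊆ squaresUnion E, hardyDual μ α ^ 2

/-- The level set `{𝕍^μ ≥ δ}` in the boundary `∂T²`. -/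
def levelSet (μ : BiTree N → ℝ) (δ : ℝ) : Set (BiTree N) :=
  {ω | ω ∈ boundary N ∧ δ ≤ potential μ ω}

open Classical in
/-- `𝓔_δ[μ] = ∑_{α ∈ E_δ} μ(R_α)²`. -/
theorem lowEnergy_eq_sum (μ : BiTree N → ℝ) (δ : ℝ) :
    lowEnergy μ δ = ∑ α with α ∈ lowNodes μ δ, hardyDual μ α ^ 2 := by
  simp only [lowEnergy, lowPotential, Finset.sum_filter, Finset.sum_mul]
  rw [Finset.sum_comm]
  refine Finset.sum_congr rfl fun β _ => ?_
  by_cases h : β ∈ lowNodes μ δ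
  · simp only [h, and_true, if_true]
    rw [sq]
    nth_rewrite 3 [hardyDual]
    rw [Finset.mul_sum, Finset.sum_filter]
    exact Finset.sum_congr rfl fun α _ => by split_ifs <;> simp
  · simp [h]

/-- `𝓔[μ] = ∑_α μ(R_α)²`. -/
theorem energy_eq_sum (μ : BiTree N → ℝ) : energy μ = ∑ α, hardyDual μ α ^ 2 := by
  classical
  simp only [energy, potential, hardy, Finset.sum_filter, Finset.sum_mul]
  rw [Finset.sum_comm]
  refine Finset.sum_congr rfl fun β _ => ?_
  rw [sq]
  nth_rewrite 3 [hardyDual]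
  rw [Finset.mul_sum, Finset.sum_filter]
  exact Finset.sum_congr rfl fun α _ => by split_ifs <;> simp

end BiTreeEnergy

end

namespace BiTreeEnergy

open Finset

/-! Let `f` be `𝕀* μ` cut off to the nodes of potential below `δ`, so that `𝕍_δ = 𝕀 f`. The core is
the second moment bound `∫ 𝕍_δ² dμ ≤ 6 δ 𝓔[μ]`. If `𝕍^μ ≥ c` on the support, then `c |μ| ≤ 𝓔[μ]`.
Integrating `t 𝕍_δ ≤ t² + 𝕍_δ²` with `t = √(c δ)` then gives `𝓔_δ ≤ 7 √(δ/c) 𝓔`.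

For the second moment, expand the square over pairs of ancestors of `ω` (`hardy_sq_le`). Comparable
pairs contribute at most `2 δ 𝕍_δ`. A crossing pair is `(a, b')`, `(a', b)` with `a ≤ a'`, `b ≤ b'`;
grouping by the corner `(a, b)` and integrating in `μ` leaves `∑ hardySnd f * hardyFst f * 𝕀* μ`.
Cauchy–Schwarz reduces this to an `ℓ²` bound for the product of the two one-parameter sums
(`sum_sq_hardySnd_mul_hardyFst_le`), which rests on a one-dimensional tree estimate applied in each
coordinate (`sum_mul_le_of_chain_sum_le`).

The local energy bound follows because `𝕍^μ` increases down the bi-tree: a rectangle of potential at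
least `δ` is covered by squares of the level set. -/

/-! ### One-dimensional estimates on chains and trees -/

open Classical in
/-- On a chain, the square of a sum is controlled by the sum over ordered pairs. -/
theorem sq_sum_le_of_total {X : Type*} [PartialOrder X] (s : Finset X) (hs : ∀ a ∈ s, ∀ b ∈ s, a ≤ b ∨ b ≤ a)
    (g : X → ℝ) (hg : ∀ a, 0 ≤ g a) :
    (∑ a ∈ s, g a) ^ 2 ≤ 2 * ∑ a ∈ s, g a * ∑ b ∈ s with a ≤ b, g b := by
  have h1 : ∑ a ∈ s, g a * ∑ b ∈ s with a ≤ b, g b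
      = ∑ a ∈ s, ∑ b ∈ s, if a ≤ b then g a * g b else 0 := by
    refine sum_congr rfl fun a _ => ?_
    rw [mul_sum, sum_filter]
  have h2 : ∑ a ∈ s, ∑ b ∈ s, (if a ≤ b then g a * g b else 0)
      = ∑ a ∈ s, ∑ b ∈ s, if b ≤ a then g a * g b else 0 := by
    rw [sum_comm]
    simp only [mul_comm]
  rw [two_mul, h1]
  nth_rewrite 2 [h2]
  rw [sq, sum_mul_sum, ← sum_add_distrib]
  refine sum_le_sum fun a ha => ?_
  rw [← sum_add_distrib]
  refine sum_le_sum fun b hb => ?_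
  have h := mul_nonneg (hg a) (hg b)
  rcases hs a ha b hb with h' | h' <;> simp only [h', if_true] <;> split_ifs <;> linarith

open Classical in
/-- Integrating a potential bounded by `δ` on the up-set `P` against the measure `m` on a tree. -/
theorem sum_mul_le_of_chain_sum_le {X : Type*} [Fintype X] [PartialOrder X]
    (hX : ∀ a b c : X, a ≤ b → a ≤ c → b ≤ c ∨ c ≤ b)
    (m u : X → ℝ) (hm : ∀ x, 0 ≤ m x) (hu : ∀ x, 0 ≤ u x) (P : X → Prop)
    (hP : ∀ a b, a ≤ b → P a → P b) (δ : ℝ) (hδ : ∀ a, P a → ∑ c with a ≤ c, u c ≤ δ) (t : X) :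
    ∑ a with a ≤ t, (if P a then ∑ x with x ≤ a, m x else 0) * u a
      ≤ δ * if P t then ∑ x with x ≤ t, m x else 0 := by
  by_cases ht : P t
  swap
  · rw [if_neg ht, mul_zero]
    refine (sum_eq_zero fun a ha => ?_).le
    rw [if_neg fun h => ht (hP a t (mem_filter.1 ha).2 h), zero_mul]
  have hδ0 : 0 ≤ δ := (sum_nonneg fun c _ => hu c).trans (hδ t ht)
  have hinner : ∀ x, ∑ a with x ≤ a ∧ a ≤ t ∧ P a, u a ≤ δ := by
    intro x
    rcases (univ.filter fun a => x ≤ a ∧ a ≤ t ∧ P a).eq_empty_or_nonempty with h | h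
    · rw [h, sum_empty]
      exact hδ0
    · obtain ⟨a, ha⟩ := exists_minimal h
      obtain ⟨hxa, hat, hPa⟩ := (mem_filter.1 ha.prop).2
      refine le_trans (sum_le_sum_of_subset_of_nonneg ?_ fun c _ _ => hu c) (hδ a hPa)
      intro c hc
      refine mem_filter.2 ⟨mem_univ _, ?_⟩
      rcases hX x a c hxa (mem_filter.1 hc).2.1 with h | h
      · exact h
      · exact ha.le_of_le hc h
  rw [if_pos ht, mul_sum]
  calc ∑ a with a ≤ t, (if P a then ∑ x with x ≤ a, m x else 0) * u a
      = ∑ x with x ≤ t, m x * ∑ a with x ≤ a ∧ a ≤ t ∧ P a, u a := by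
        simp only [sum_filter, mul_sum]
        have : ∀ a : X, (if a ≤ t then (if P a then ∑ x, if x ≤ a then m x else 0 else 0) * u a
            else 0) = ∑ x, if x ≤ a ∧ a ≤ t ∧ P a then m x * u a else 0 := by
          intro a
          by_cases h1 : a ≤ t <;> by_cases h2 : P a <;> simp [h1, h2, sum_mul]
        simp only [this]
        rw [sum_comm]
        refine sum_congr rfl fun x _ => ?_
        by_cases h : x ≤ t
        · simp only [h, if_true, mul_ite, mul_zero]
        · rw [if_neg h]
          refine sum_eq_zero fun a _ => if_neg fun h' => h (h'.1.trans h'.2.1)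
    _ ≤ ∑ x with x ≤ t, δ * m x := by
        refine sum_le_sum fun x _ => ?_
        rw [mul_comm δ]
        exact mul_le_mul_of_nonneg_left (hinner x) (hm x)

/-! ### Ancestors and leaves of the dyadic tree -/

variable {N : ℕ}

theorem Node.le_total_of_le (a b c : Node N) (hb : a ≤ b) (hc : a ≤ c) : b ≤ c ∨ c ≤ b := by
  rw [Node.le_iff] at hb hc
  have key : ∀ b c : Node N, b.gen ≤ a.gen → a.pos / 2 ^ (a.gen - b.gen) = b.pos →
      a.pos / 2 ^ (a.gen - c.gen) = c.pos → c.gen ≤ b.gen → b ≤ c := by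
    intro b c h1 h2 h3 h4
    rw [Node.le_iff]
    refine ⟨h4, ?_⟩
    rw [← h2, ← h3, Nat.div_div_eq_div_mul, ← pow_add]
    congr 2
    omega
  rcases le_total c.gen b.gen with h | h
  · exact Or.inl (key b c hb.1 hb.2 hc.2 h)
  · exact Or.inr (key c b hc.1 hc.2 hb.2 h)

theorem Node.exists_leaf (a : Node N) {x : ℝ} (hx : x ∈ a.interval) :
    ∃ w : Node N, w.gen = N ∧ x ∈ w.interval ∧ w ≤ a := by
  obtain ⟨h1, h2⟩ := hx
  have hA : (0 : ℝ) < 2 ^ a.gen := by positivity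
  have hN : (0 : ℝ) < 2 ^ N := by positivity
  rw [div_le_iff₀ hA] at h1
  rw [lt_div_iff₀ hA] at h2
  have hx0 : 0 ≤ x := by
    by_contra h
    nlinarith [(Nat.cast_nonneg a.pos : (0 : ℝ) ≤ a.pos), mul_neg_of_neg_of_pos (not_le.1 h) hA]
  have hx1 : x < 1 := by
    have : (a.pos : ℝ) + 1 ≤ 2 ^ a.gen := by exact_mod_cast a.pos_lt
    by_contra h
    nlinarith [mul_le_mul_of_nonneg_right (not_lt.1 h) hA.le]
  have hxN : 0 ≤ x * 2 ^ N := by positivity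
  refine ⟨⟨N, ⌊x * 2 ^ N⌋₊, le_rfl, ?_⟩, rfl, ⟨?_, ?_⟩, ?_⟩
  · rw [Nat.floor_lt hxN]
    push_cast
    nlinarith
  · rw [div_le_iff₀ hN]
    exact Nat.floor_le hxN
  · rw [lt_div_iff₀ hN]
    exact Nat.lt_floor_add_one _
  · rw [Node.le_iff]
    refine ⟨a.gen_le, ?_⟩
    have hd : x * 2 ^ N / ((2 ^ (N - a.gen) : ℕ) : ℝ) = x * 2 ^ a.gen := by
      obtain ⟨d, hd⟩ := Nat.exists_eq_add_of_le a.gen_le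
      have hd' : N - a.gen = d := by omega
      rw [hd', div_eq_iff (by positivity)]
      push_cast
      rw [mul_assoc, ← pow_add, ← hd]
    change ⌊x * 2 ^ N⌋₊ / 2 ^ (N - a.gen) = a.pos
    rw [← Nat.floor_div_natCast, hd, Nat.floor_eq_iff (by positivity)]
    exact ⟨h1, h2⟩

/-! ### Coordinatewise sums and pairs of ancestors -/

open Classical in
/-- Summation over the ancestors in the first coordinate. -/
noncomputable def hardyFst (f : BiTree N → ℝ) (p : BiTree N) : ℝ := ∑ a with p.1 ≤ a, f (a, p.2)

open Classical in
/-- Summation over the ancestors in the second coordinate. -/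
noncomputable def hardySnd (f : BiTree N → ℝ) (p : BiTree N) : ℝ := ∑ b with p.2 ≤ b, f (p.1, b)

theorem hardyFst_nonneg {f : BiTree N → ℝ} (hf : ∀ p, 0 ≤ f p) (p : BiTree N) :
    0 ≤ hardyFst f p := sum_nonneg fun _ _ => hf _

theorem hardySnd_nonneg {f : BiTree N → ℝ} (hf : ∀ p, 0 ≤ f p) (p : BiTree N) :
    0 ≤ hardySnd f p := sum_nonneg fun _ _ => hf _

open Classical in
theorem hardy_eq_sum_hardySnd (f : BiTree N → ℝ) (p : BiTree N) :
    hardy f p = ∑ a with p.1 ≤ a, hardySnd f (a, p.2) := by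
  simp only [hardy, hardySnd, sum_filter, Fintype.sum_prod_type, Prod.le_def]
  refine sum_congr rfl fun a _ => ?_
  by_cases h : p.1 ≤ a <;> simp [h]

open Classical in
theorem hardy_eq_sum_hardyFst (f : BiTree N → ℝ) (p : BiTree N) :
    hardy f p = ∑ b with p.2 ≤ b, hardyFst f (p.1, b) := by
  simp only [hardy, hardyFst, sum_filter, Fintype.sum_prod_type_right, Prod.le_def]
  refine sum_congr rfl fun b _ => ?_
  by_cases h : p.2 ≤ b <;> simp [h]

-- The product at `(a, b)` pairs `(a, b')` with `(a', b)`, where `a ≤ a'` and `b ≤ b'`. A crossing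
-- pair determines its corner `(a, b)`, so each such pair is counted exactly once.
open Classical in
theorem hardy_hardySnd_mul_hardyFst (f : BiTree N → ℝ) (ω : BiTree N) :
    hardy (fun p => hardySnd f p * hardyFst f p) ω =
      ∑ p with ω ≤ p, ∑ q with ω ≤ q, if p.1 ≤ q.1 ∧ q.2 ≤ p.2 then f p * f q else 0 := by
  simp only [hardy, hardySnd, hardyFst, sum_filter, Fintype.sum_prod_type, Prod.le_def]
  refine sum_congr rfl fun a _ => ?_
  have h1 : ∀ b : Node N, (if ω.1 ≤ a ∧ ω.2 ≤ b then
      (∑ b', if b ≤ b' then f (a, b') else 0) * ∑ a', if a ≤ a' then f (a', b) else 0 else 0) =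
      ∑ b', ∑ a', if ω.1 ≤ a ∧ ω.2 ≤ b ∧ b ≤ b' ∧ a ≤ a' then f (a, b') * f (a', b) else 0 := by
    intro b
    rw [sum_mul_sum]
    by_cases h : ω.1 ≤ a ∧ ω.2 ≤ b
    · rw [if_pos h]
      refine sum_congr rfl fun b' _ => sum_congr rfl fun a' _ => ?_
      by_cases h3 : b ≤ b' <;> by_cases h4 : a ≤ a' <;> simp [h3, h4, h.1, h.2]
    · rw [if_neg h]
      refine (sum_eq_zero fun b' _ => sum_eq_zero fun a' _ => if_neg fun h' => ?_).symm
      exact h ⟨h'.1, h'.2.1⟩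
  simp only [h1]
  rw [sum_comm]
  refine sum_congr rfl fun b' _ => ?_
  rw [sum_comm]
  by_cases h : ω.1 ≤ a ∧ ω.2 ≤ b'
  · rw [if_pos h]
    refine sum_congr rfl fun a' _ => sum_congr rfl fun b _ => ?_
    rw [← ite_and]
    refine if_congr ⟨fun h' => ?_, fun h' => ?_⟩ rfl rfl
    · exact ⟨⟨h'.1.trans h'.2.2.2, h'.2.1⟩, h'.2.2.2, h'.2.2.1⟩
    · exact ⟨h.1, h'.1.2, h'.2.2, h'.2.1⟩
  · rw [if_neg h]
    refine sum_eq_zero fun a' _ => sum_eq_zero fun b _ => if_neg fun h' => ?_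
    exact h ⟨h'.1, h'.2.1.trans h'.2.2.1⟩

/-- Two ancestors of a node are comparable, or each is smaller in exactly one coordinate. -/
theorem hardy_sq_le (f : BiTree N → ℝ) (hf : ∀ p, 0 ≤ f p) (ω : BiTree N) :
    hardy f ω ^ 2 ≤ 2 * hardy (fun p => f p * hardy f p) ω +
      2 * hardy (fun p => hardySnd f p * hardyFst f p) ω := by
  classical
  rw [hardy_hardySnd_mul_hardyFst]
  have h1 : hardy (fun p => f p * hardy f p) ω =
      ∑ p with ω ≤ p, ∑ q with ω ≤ q, if p ≤ q then f p * f q else 0 := by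
    unfold hardy
    refine sum_congr rfl fun p hp => ?_
    have hp := (mem_filter.1 hp).2
    simp only [mul_sum, sum_filter]
    refine sum_congr rfl fun q _ => ?_
    by_cases h : p ≤ q
    · simp [h, hp.trans h]
    · simp [h]
  have h2 : ∑ p with ω ≤ p, ∑ q with ω ≤ q, (if p ≤ q then f p * f q else 0) =
      ∑ p with ω ≤ p, ∑ q with ω ≤ q, if q ≤ p then f p * f q else 0 := by
    rw [sum_comm]
    simp only [mul_comm]
  have h3 : ∑ p with ω ≤ p, ∑ q with ω ≤ q,
        (if p.1 ≤ q.1 ∧ q.2 ≤ p.2 then f p * f q else 0) =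
      ∑ p with ω ≤ p, ∑ q with ω ≤ q, if q.1 ≤ p.1 ∧ p.2 ≤ q.2 then f p * f q else 0 := by
    rw [sum_comm]
    simp only [mul_comm]
  -- Each doubled sum is split into itself and its transpose, so that all four relative positions of
  -- `p` and `q` are covered.
  rw [h1, two_mul, two_mul]
  nth_rewrite 2 [h2]
  nth_rewrite 2 [h3]
  unfold hardy
  rw [sq, sum_mul_sum]
  simp only [← sum_add_distrib]
  refine sum_le_sum fun p hp => sum_le_sum fun q hq => ?_
  have hp := (mem_filter.1 hp).2
  have hq := (mem_filter.1 hq).2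
  have h := mul_nonneg (hf p) (hf q)
  have n1 : ∀ (P : Prop) [Decidable P], 0 ≤ if P then f p * f q else 0 := by
    intro P _
    split_ifs <;> simp [h]
  have a1 := n1 (p ≤ q)
  have a2 := n1 (q ≤ p)
  have a3 := n1 (p.1 ≤ q.1 ∧ q.2 ≤ p.2)
  have a4 := n1 (q.1 ≤ p.1 ∧ p.2 ≤ q.2)
  rcases Node.le_total_of_le _ _ _ hp.1 hq.1 with h' | h' <;>
    rcases Node.le_total_of_le _ _ _ hp.2 hq.2 with h'' | h''
  · rw [if_pos (show p ≤ q from ⟨h', h''⟩)] at a1 ⊢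
    linarith
  · rw [if_pos (show p.1 ≤ q.1 ∧ q.2 ≤ p.2 from ⟨h', h''⟩)] at a3 ⊢
    linarith
  · rw [if_pos (show q.1 ≤ p.1 ∧ p.2 ≤ q.2 from ⟨h', h''⟩)] at a4 ⊢
    linarith
  · rw [if_pos (show q ≤ p from ⟨h', h''⟩)] at a2 ⊢
    linarith

open Classical in
theorem hardyFst_sq_le (f : BiTree N → ℝ) (hf : ∀ p, 0 ≤ f p) (p : BiTree N) :
    hardyFst f p ^ 2 ≤ 2 * ∑ a with p.1 ≤ a, f (a, p.2) * hardyFst f (a, p.2) := by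
  refine (sq_sum_le_of_total _ (fun a ha b hb => Node.le_total_of_le p.1 a b
    (mem_filter.1 ha).2 (mem_filter.1 hb).2) _ fun a => hf _).trans ?_
  gcongr with a
  · exact hf _
  · exact sum_le_sum_of_subset_of_nonneg (fun b hb => by simp_all) fun b _ _ => hf _

open Classical in
theorem hardySnd_sq_le (f : BiTree N → ℝ) (hf : ∀ p, 0 ≤ f p) (p : BiTree N) :
    hardySnd f p ^ 2 ≤ 2 * ∑ b with p.2 ≤ b, f (p.1, b) * hardySnd f (p.1, b) := by
  refine (sq_sum_le_of_total _ (fun a ha b hb => Node.le_total_of_le p.2 a b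
    (mem_filter.1 ha).2 (mem_filter.1 hb).2) _ fun a => hf _).trans ?_
  gcongr with a
  · exact hf _
  · exact sum_le_sum_of_subset_of_nonneg (fun b hb => by simp_all) fun b _ _ => hf _

theorem sum_comm_four {X Y : Type*} [Fintype X] [Fintype Y] (G : X → Y → Y → X → ℝ) :
    ∑ a, ∑ b, ∑ b', ∑ a', G a b b' a' = ∑ a', ∑ b', ∑ a, ∑ b, G a b b' a' := by
  calc ∑ a, ∑ b, ∑ b', ∑ a', G a b b' a'
      = ∑ p : X × Y, ∑ q : X × Y, G p.1 p.2 q.2 q.1 := by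
        simp only [Fintype.sum_prod_type]
        exact sum_congr rfl fun a _ => sum_congr rfl fun b _ => sum_comm
    _ = ∑ a', ∑ b', ∑ a, ∑ b, G a b b' a' := by
        rw [sum_comm]
        simp only [Fintype.sum_prod_type]

-- Each one-parameter square is opened into a sum over a further ancestor. Regrouping by the far
-- corner `(a', b')` factors the sum into the two expressions bounded by `h1` and `h2`.
open Classical in
theorem sum_sq_hardySnd_mul_hardyFst_le (f : BiTree N → ℝ) (hf : ∀ p, 0 ≤ f p) (δ : ℝ)
    (h1 : ∀ p : BiTree N, ∑ a with a ≤ p.1, f (a, p.2) * hardySnd f (a, p.2) ≤ δ * f p)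
    (h2 : ∀ p : BiTree N, ∑ b with b ≤ p.2, f (p.1, b) * hardyFst f (p.1, b) ≤ δ * f p) :
    ∑ p, (hardySnd f p * hardyFst f p) ^ 2 ≤ 4 * δ ^ 2 * ∑ p, f p ^ 2 := by
  have hS := hardySnd_nonneg hf
  have hF := hardyFst_nonneg hf
  calc ∑ p, (hardySnd f p * hardyFst f p) ^ 2
      ≤ ∑ p : BiTree N, (2 * ∑ b with p.2 ≤ b, f (p.1, b) * hardySnd f (p.1, b)) *
          (2 * ∑ a with p.1 ≤ a, f (a, p.2) * hardyFst f (a, p.2)) := by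
        refine sum_le_sum fun p _ => ?_
        rw [mul_pow]
        exact mul_le_mul (hardySnd_sq_le f hf p) (hardyFst_sq_le f hf p) (sq_nonneg _)
          ((sq_nonneg _).trans (hardySnd_sq_le f hf p))
    _ = 4 * ∑ p : BiTree N, (∑ a with a ≤ p.1, f (a, p.2) * hardySnd f (a, p.2)) *
          ∑ b with b ≤ p.2, f (p.1, b) * hardyFst f (p.1, b) := by
        simp only [mul_mul_mul_comm (2 : ℝ), ← mul_sum]
        rw [show (2 : ℝ) * 2 = 4 by norm_num]
        congr 1
        simp only [sum_mul_sum, sum_filter, Fintype.sum_prod_type]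
        refine (sum_comm_four _).trans ?_
        refine sum_congr rfl fun a' _ => sum_congr rfl fun b' _ => sum_congr rfl fun a _ =>
          sum_congr rfl fun b _ => ?_
        split_ifs <;> simp
    _ ≤ 4 * ∑ p : BiTree N, (δ * f p) * (δ * f p) := by
        gcongr with p
        · exact sum_nonneg fun b _ => mul_nonneg (hf _) (hF _)
        · exact (sum_nonneg fun b _ => mul_nonneg (hf _) (hS _)).trans (h1 p)
        · exact h1 p
        · exact h2 p
    _ = 4 * δ ^ 2 * ∑ p, f p ^ 2 := by
        rw [mul_sum, mul_sum]
        exact sum_congr rfl fun p _ => by ring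

/-! ### The small energy estimate -/

open Classical in
/-- The dual Hardy transform `𝕀* μ` restricted to the nodes of potential below `δ`. -/
noncomputable def lowMass (μ : BiTree N → ℝ) (δ : ℝ) (p : BiTree N) : ℝ :=
  if potential μ p < δ then hardyDual μ p else 0

theorem hardyDual_nonneg {μ : BiTree N → ℝ} (hμ : ∀ p, 0 ≤ μ p) (p : BiTree N) :
    0 ≤ hardyDual μ p := sum_nonneg fun _ _ => hμ _

theorem hardy_mono {f g : BiTree N → ℝ} (h : ∀ p, f p ≤ g p) (p : BiTree N) :
    hardy f p ≤ hardy g p := sum_le_sum fun _ _ => h _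

theorem hardy_antitone {f : BiTree N → ℝ} (hf : ∀ p, 0 ≤ f p) : Antitone (hardy f) := by
  classical
  intro p q h
  refine sum_le_sum_of_subset_of_nonneg (fun r hr => ?_) fun r _ _ => hf r
  simp only [mem_filter, mem_univ, true_and] at hr ⊢
  exact h.trans hr

theorem potential_antitone {μ : BiTree N → ℝ} (hμ : ∀ p, 0 ≤ μ p) : Antitone (potential μ) :=
  hardy_antitone (hardyDual_nonneg hμ)

open Classical in
theorem hardyDual_eq_sum_sum (μ : BiTree N → ℝ) (p : BiTree N) :
    hardyDual μ p = ∑ a with a ≤ p.1, ∑ b with b ≤ p.2, μ (a, b) := by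
  simp only [hardyDual, sum_filter, Fintype.sum_prod_type, Prod.le_def]
  refine sum_congr rfl fun a _ => ?_
  by_cases h : a ≤ p.1 <;> simp [h]

open Classical in
theorem hardyDual_eq_sum_sum' (μ : BiTree N → ℝ) (p : BiTree N) :
    hardyDual μ p = ∑ b with b ≤ p.2, ∑ a with a ≤ p.1, μ (a, b) := by
  simp only [hardyDual, sum_filter, Fintype.sum_prod_type_right, Prod.le_def]
  refine sum_congr rfl fun b _ => ?_
  by_cases h : b ≤ p.2 <;> simp [h]

theorem sum_hardy_mul (φ μ : BiTree N → ℝ) :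
    ∑ ω, hardy φ ω * μ ω = ∑ p, φ p * hardyDual μ p := by
  classical
  simp only [hardy, hardyDual, sum_filter, sum_mul, mul_sum]
  rw [sum_comm]
  refine sum_congr rfl fun p _ => sum_congr rfl fun ω _ => ?_
  split_ifs <;> simp

section LowMass

variable {μ : BiTree N → ℝ}

theorem lowMass_nonneg (hμ : ∀ p, 0 ≤ μ p) (δ : ℝ) (p : BiTree N) : 0 ≤ lowMass μ δ p := by
  unfold lowMass
  split_ifs
  · exact hardyDual_nonneg hμ p
  · exact le_rfl

theorem lowMass_le (hμ : ∀ p, 0 ≤ μ p) (δ : ℝ) (p : BiTree N) :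
    lowMass μ δ p ≤ hardyDual μ p := by
  unfold lowMass
  split_ifs
  · exact le_rfl
  · exact hardyDual_nonneg hμ p

theorem hardy_lowMass (δ : ℝ) (p : BiTree N) :
    hardy (lowMass μ δ) p = lowPotential μ δ p := by
  classical
  simp only [hardy, lowMass, lowPotential, lowNodes, Set.mem_ofPred_eq, ← sum_filter,
    filter_filter]
  congr!

theorem lowMass_mul_hardy_le (hμ : ∀ p, 0 ≤ μ p) (δ : ℝ) (p : BiTree N) :
    lowMass μ δ p * hardy (lowMass μ δ) p ≤ δ * lowMass μ δ p := by
  by_cases h : potential μ p < δ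
  · rw [mul_comm]
    exact mul_le_mul_of_nonneg_right
      ((hardy_mono (lowMass_le hμ δ) p).trans h.le) (lowMass_nonneg hμ δ p)
  · simp [lowMass, h]

-- With the second coordinate fixed, this is the tree estimate: nodes of potential below `δ` form an
-- up-set, and summing `hardySnd` along the first coordinate rebuilds `hardy`, which is at most
-- `potential μ` and hence below `δ` there.
open Classical in
theorem sum_lowMass_mul_hardySnd_le (hμ : ∀ p, 0 ≤ μ p) (δ : ℝ) (p : BiTree N) :
    ∑ a with a ≤ p.1, lowMass μ δ (a, p.2) * hardySnd (lowMass μ δ) (a, p.2)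
      ≤ δ * lowMass μ δ p := by
  have h := sum_mul_le_of_chain_sum_le (X := Node N) Node.le_total_of_le
    (fun x => ∑ b with b ≤ p.2, μ (x, b)) (fun a => hardySnd (lowMass μ δ) (a, p.2))
    (fun x => sum_nonneg fun _ _ => hμ _) (fun x => hardySnd_nonneg (lowMass_nonneg hμ δ) _)
    (fun a => potential μ (a, p.2) < δ)
    (fun a b hab ha => (potential_antitone hμ
      (show (a, p.2) ≤ (b, p.2) from ⟨hab, le_rfl⟩)).trans_lt ha) δ
    (fun a ha => by
      rw [← hardy_eq_sum_hardySnd (lowMass μ δ) (a, p.2)]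
      exact (hardy_mono (lowMass_le hμ δ) _).trans ha.le) p.1
  simpa only [lowMass, hardyDual_eq_sum_sum] using h

open Classical in
theorem sum_lowMass_mul_hardyFst_le (hμ : ∀ p, 0 ≤ μ p) (δ : ℝ) (p : BiTree N) :
    ∑ b with b ≤ p.2, lowMass μ δ (p.1, b) * hardyFst (lowMass μ δ) (p.1, b)
      ≤ δ * lowMass μ δ p := by
  have h := sum_mul_le_of_chain_sum_le (X := Node N) Node.le_total_of_le
    (fun x => ∑ a with a ≤ p.1, μ (a, x)) (fun b => hardyFst (lowMass μ δ) (p.1, b))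
    (fun x => sum_nonneg fun _ _ => hμ _) (fun x => hardyFst_nonneg (lowMass_nonneg hμ δ) _)
    (fun b => potential μ (p.1, b) < δ)
    (fun a b hab ha => (potential_antitone hμ
      (show (p.1, a) ≤ (p.1, b) from ⟨le_rfl, hab⟩)).trans_lt ha) δ
    (fun b hb => by
      rw [← hardy_eq_sum_hardyFst (lowMass μ δ) (p.1, b)]
      exact (hardy_mono (lowMass_le hμ δ) _).trans hb.le) p.2
  simpa only [lowMass, hardyDual_eq_sum_sum'] using h

theorem energy_nonneg (μ : BiTree N → ℝ) : 0 ≤ energy μ := by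
  rw [energy_eq_sum]
  exact sum_nonneg fun _ _ => sq_nonneg _

theorem sum_sq_lowMass_le (hμ : ∀ p, 0 ≤ μ p) (δ : ℝ) : ∑ p, lowMass μ δ p ^ 2 ≤ energy μ := by
  rw [energy_eq_sum]
  exact sum_le_sum fun p _ => pow_le_pow_left₀ (lowMass_nonneg hμ δ p) (lowMass_le hμ δ p) 2

theorem lowEnergy_le_energy (μ : BiTree N → ℝ) (δ : ℝ) : lowEnergy μ δ ≤ energy μ := by
  classical
  rw [energy_eq_sum, lowEnergy_eq_sum]
  exact sum_le_sum_of_subset_of_nonneg (filter_subset _ _) fun _ _ _ => sq_nonneg _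

theorem sum_hardySnd_mul_hardyFst_mul_hardyDual_le (hμ : ∀ p, 0 ≤ μ p) {δ : ℝ} (hδ : 0 ≤ δ) :
    ∑ p, hardySnd (lowMass μ δ) p * hardyFst (lowMass μ δ) p * hardyDual μ p
      ≤ 2 * δ * energy μ := by
  have h := sum_sq_hardySnd_mul_hardyFst_le (lowMass μ δ) (lowMass_nonneg hμ δ) δ
    (sum_lowMass_mul_hardySnd_le hμ δ) (sum_lowMass_mul_hardyFst_le hμ δ)
  have hE := energy_nonneg μ
  refine le_of_sq_le_sq ?_ (by positivity)
  calc _ ≤ _ := sum_mul_sq_le_sq_mul_sq _ _ _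
    _ ≤ (4 * δ ^ 2 * energy μ) * energy μ := by
      rw [← energy_eq_sum]
      gcongr
      exact h.trans (by gcongr; exact sum_sq_lowMass_le hμ δ)
    _ = (2 * δ * energy μ) ^ 2 := by ring

theorem mul_sum_le_energy (hμ : ∀ p, 0 ≤ μ p) {c : ℝ} (hc : ∀ ω, μ ω ≠ 0 → c ≤ potential μ ω) :
    c * ∑ ω, μ ω ≤ energy μ := by
  rw [mul_sum]
  refine sum_le_sum fun ω _ => ?_
  by_cases h : μ ω = 0
  · simp [h]
  · exact mul_le_mul_of_nonneg_right (hc ω h) (hμ ω)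

/-- Of the constant `6`, comparable pairs account for `2` and crossing pairs for `2 * 2`. -/
theorem sum_lowPotential_sq_le (hμ : ∀ p, 0 ≤ μ p) {δ : ℝ} (hδ : 0 ≤ δ) :
    ∑ ω, lowPotential μ δ ω ^ 2 * μ ω ≤ 6 * δ * energy μ := by
  have h1 : ∀ ω, lowPotential μ δ ω ^ 2 * μ ω ≤ 2 * δ * (lowPotential μ δ ω * μ ω) +
      2 * (hardy (fun p => hardySnd (lowMass μ δ) p * hardyFst (lowMass μ δ) p) ω * μ ω) := by
    intro ω
    have h2 := hardy_sq_le (lowMass μ δ) (lowMass_nonneg hμ δ) ω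
    have h3 : hardy (fun p => lowMass μ δ p * hardy (lowMass μ δ) p) ω ≤
        δ * hardy (lowMass μ δ) ω := by
      refine (hardy_mono (lowMass_mul_hardy_le hμ δ) ω).trans_eq ?_
      simp only [hardy, mul_sum]
    rw [hardy_lowMass] at h2 h3
    calc lowPotential μ δ ω ^ 2 * μ ω ≤ (2 * (δ * lowPotential μ δ ω) + 2 *
          hardy (fun p => hardySnd (lowMass μ δ) p * hardyFst (lowMass μ δ) p) ω) * μ ω :=
          mul_le_mul_of_nonneg_right (by linarith) (hμ ω)
      _ = _ := by ring
  refine (sum_le_sum fun ω _ => h1 ω).trans ?_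
  rw [sum_add_distrib, ← mul_sum, ← mul_sum, sum_hardy_mul]
  have h4 := sum_hardySnd_mul_hardyFst_mul_hardyDual_le hμ hδ
  have h5 := mul_le_mul_of_nonneg_left (lowEnergy_le_energy μ δ) hδ
  unfold lowEnergy at h5
  linarith

/-- Small energy estimate: the nodes of potential below `δ` carry little energy. -/
theorem lowEnergy_le (hμ : ∀ p, 0 ≤ μ p) {c : ℝ} (hc : 0 < c)
    (hsupp : ∀ ω, μ ω ≠ 0 → c ≤ potential μ ω) {δ : ℝ} (hδ : 0 < δ) :
    lowEnergy μ δ ≤ 7 * √(δ / c) * energy μ := by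
  set s := √(δ / c) with hs_def
  have hs : 0 < s := Real.sqrt_pos.2 (div_pos hδ hc)
  have hss : c * s * s = δ := by
    rw [mul_assoc, Real.mul_self_sqrt (div_pos hδ hc).le]
    field_simp
  have hl : 0 < c * s := mul_pos hc hs
  -- The threshold `c * s = √(c δ)` balances the terms: since `c |μ| ≤ 𝓔[μ]`, the first integrates
  -- to at most `δ 𝓔[μ]`, the second to at most `6 δ 𝓔[μ]`.
  have h1 : ∀ ω, c * s * (lowPotential μ δ ω * μ ω) ≤
      (c * s) * (c * s) * μ ω + lowPotential μ δ ω ^ 2 * μ ω := by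
    intro ω
    rw [← mul_assoc, ← add_mul]
    refine mul_le_mul_of_nonneg_right ?_ (hμ ω)
    nlinarith [sq_nonneg (c * s - lowPotential μ δ ω), sq_nonneg (c * s),
      sq_nonneg (lowPotential μ δ ω)]
  have h2 := sum_le_sum fun ω (_ : ω ∈ univ) => h1 ω
  rw [sum_add_distrib, ← mul_sum, ← mul_sum] at h2
  have h3 := sum_lowPotential_sq_le hμ hδ.le
  have h4 := mul_le_mul_of_nonneg_left (mul_sum_le_energy hμ hsupp) (mul_pos hl hs).le
  have h5 : c * s * lowEnergy μ δ ≤ c * s * (7 * s * energy μ) := by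
    unfold lowEnergy
    rw [← hss] at h3
    rw [← hss] at h2
    rw [← hss]
    nlinarith [h2, h3, h4]
  exact le_of_mul_le_mul_left h5 hl

end LowMass

/-! ### Local energy of level sets -/

open Classical in
theorem sum_sq_eq_energy_sub_lowEnergy (μ : BiTree N → ℝ) (δ : ℝ) :
    ∑ α with δ ≤ potential μ α, hardyDual μ α ^ 2 = energy μ - lowEnergy μ δ := by
  rw [eq_sub_iff_add_eq, energy_eq_sum, lowEnergy_eq_sum, add_comm,
    ← sum_filter_add_sum_filter_not univ (fun α => α ∈ lowNodes μ δ)]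
  simp only [lowNodes, Set.mem_ofPred_eq, not_lt]

theorem rect_subset_squaresUnion {μ : BiTree N → ℝ} (hμ : ∀ p, 0 ≤ μ p) {δ : ℝ} {α : BiTree N}
    (hα : δ ≤ potential μ α) : rect α ⊆ squaresUnion (levelSet μ δ) := by
  rintro ⟨x, y⟩ ⟨hx, hy⟩
  obtain ⟨v, hv, hxv, hva⟩ := α.1.exists_leaf hx
  obtain ⟨w, hw, hyw, hwa⟩ := α.2.exists_leaf hy
  have h : (v, w) ≤ α := ⟨hva, hwa⟩
  exact Set.mem_iUnion₂.2 ⟨(v, w), ⟨⟨hv, hw⟩, hα.trans (potential_antitone hμ h)⟩, hxv, hyw⟩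

open Classical in
theorem sum_sq_le_localEnergy {μ : BiTree N → ℝ} (hμ : ∀ p, 0 ≤ μ p) (δ : ℝ) :
    ∑ α with δ ≤ potential μ α, hardyDual μ α ^ 2 ≤ localEnergy μ (levelSet μ δ) := by
  refine sum_le_sum_of_subset_of_nonneg (fun α hα => ?_) fun _ _ _ => sq_nonneg _
  exact mem_filter.2 ⟨mem_univ _, rect_subset_squaresUnion hμ (mem_filter.1 hα).2⟩

end BiTreeEnergy

theorem lemma6p5 :
    ∃ C : ℝ, 0 < C ∧
      (∀ (N : ℕ) (μ : BiTreeEnergy.BiTree N → ℝ), BiTreeEnergy.IsBoundaryMeasure μ →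
        (∀ ω, μ ω ≠ 0 → 1 ≤ BiTreeEnergy.potential μ ω) →
        ∀ δ : ℝ, 0 < δ →
          BiTreeEnergy.lowEnergy μ δ ≤ C * δ ^ (1 / 2 : ℝ) * BiTreeEnergy.energy μ ∧
          (∑ α with δ ≤ BiTreeEnergy.potential μ α, BiTreeEnergy.hardyDual μ α ^ 2) ≤
            BiTreeEnergy.localEnergy μ (BiTreeEnergy.levelSet μ δ) ∧
          (∑ α with δ ≤ BiTreeEnergy.potential μ α, BiTreeEnergy.hardyDual μ α ^ 2) =
            BiTreeEnergy.energy μ - BiTreeEnergy.lowEnergy μ δ ∧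
          (1 - C * δ ^ (1 / 2 : ℝ)) * BiTreeEnergy.energy μ ≤
            BiTreeEnergy.energy μ - BiTreeEnergy.lowEnergy μ δ ∧
          (1 - C * δ ^ (1 / 2 : ℝ)) * BiTreeEnergy.energy μ ≤
            BiTreeEnergy.localEnergy μ (BiTreeEnergy.levelSet μ δ)) ∧
      (∀ (N : ℕ) (ν : BiTreeEnergy.BiTree N → ℝ), BiTreeEnergy.IsBoundaryMeasure ν →
        ∀ C₁ : ℝ, 0 < C₁ →
          (∀ ω, ν ω ≠ 0 → C₁ ≤ BiTreeEnergy.potential ν ω) →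
          1 / 2 * BiTreeEnergy.energy ν ≤
            BiTreeEnergy.localEnergy ν (BiTreeEnergy.levelSet ν (C₁ / (4 * C)))) := by
  -- Part (1) only needs `C ≥ 7`. Part (2) takes `δ = C₁ / (4 * C)` and needs `7 * √(1 / (4 * C)) ≤
  -- 1 / 2`, that is, `C ≥ 49`.
  refine ⟨49, by norm_num, ?_, ?_⟩
  · intro N μ hμ hsupp δ hδ
    have hE := BiTreeEnergy.energy_nonneg μ
    have h1 : BiTreeEnergy.lowEnergy μ δ ≤ 49 * δ ^ (1 / 2 : ℝ) * BiTreeEnergy.energy μ := by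
      refine (BiTreeEnergy.lowEnergy_le hμ.nonneg one_pos hsupp hδ).trans ?_
      rw [div_one, ← Real.sqrt_eq_rpow]
      gcongr
      norm_num
    have h2 := BiTreeEnergy.sum_sq_eq_energy_sub_lowEnergy μ δ
    have h3 := BiTreeEnergy.sum_sq_le_localEnergy hμ.nonneg δ
    have h4 : (1 - 49 * δ ^ (1 / 2 : ℝ)) * BiTreeEnergy.energy μ ≤
        BiTreeEnergy.energy μ - BiTreeEnergy.lowEnergy μ δ := by linarith
    refine ⟨h1, ?_, ?_, h4, ?_⟩
    · convert h3
    · convert h2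
    · linarith
  · intro N ν hν c hc hsupp
    have hδ : 0 < c / (4 * 49) := by positivity
    have h1 := BiTreeEnergy.lowEnergy_le hν.nonneg hc hsupp hδ
    have h2 := BiTreeEnergy.sum_sq_eq_energy_sub_lowEnergy ν (c / (4 * 49))
    have h3 := BiTreeEnergy.sum_sq_le_localEnergy hν.nonneg (c / (4 * 49))
    have h4 : √(c / (4 * 49) / c) = 1 / 14 := by
      have : c / (4 * 49) / c = (1 / 14) ^ 2 := by
        field_simp
        norm_num
      rw [this, Real.sqrt_sq (by norm_num)]
    rw [h4] at h1
    linarith
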